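/- Let $G$ be an Abelian group. A sequence $(a_n)_{n\in\omega}$ in $G$ is a $T$-sequence if it converges to $0$ in some Hausdorff group topology on $G$; it is trivial if $a_n=0$ for all but finitely many $n$. For a $T$-sequence $(a_n)$, let $\tau_{(a_n)}$ be the strongest group topology on $G$ in which $(a_n)$ converges to $0$, and let $\mathcal{I}_{(a_n)}$ be the ideal of all precompact subsets of $(G,\tau_{(a_n)})$, i.e. subsets with compact closure. The coarse group $(G,\mathcal{I}_{(a_n)})$ is $G$ with the coarse structure having as entourages all sets $E$ with $\{(x,x):x\in G\}\subseteq E\subseteq\{(x,y)\in G\times G: x-y\in P\}$ for some $P\in\mathcal{I}_{(a_n)}$. The Hamming space $\mathbb{H}$ is the set of all finite subsets of $\omega$ with the coarse structure of the metric $h(F,H)=|F\triangle H|$. An asymorphism of coarse spaces is a bijection $f$ such that $f$ and $f^{-1}$ are macro-uniform, where $g:X\to X'$ is macro-uniform if for every entourage $E$ of $X$ there is an entourage $E'$ of $X'$ such that $g(E[x])\subseteq E'[g(x)]$ for all $x\in X$; here $E[x]=\{y:(x,y)\in E\}$. Theorem 3. Let $(a_n)_{n\in\omega}$ be a non-trivial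 $T$-sequence in an Abelian group $G$. Then there is a subsequence $(b_n)_{n\in\omega}$ of $(a_n)$ that is FS-strict, i.e. $\sum_{i\in H}b_i=\sum_{i\in F}b_i$ implies $F=H$ for all finite $F,H\subseteq\omega$, such that the map $F\mapsto\sum_{i\in F}b_i$ is an asymorphism from $\mathbb{H}$ onto the subspace $\{\sum_{i\in F}b_i: F\subseteq\omega\text{ finite}\}$ of $(G,\mathcal{I}_{(a_n)})$. In particular, $(G,\mathcal{I}_{(a_n)})$ contains a subspace asymorphic to $\mathbb{H}$. Moreover, the asymptotic dimension of $(G,\mathcal{I}_{(a_n)})$ is infinite: $\mathrm{asdim}(G,\mathcal{I}_{(a_n)})=\infty$. (Here $\mathrm{asdim}\,X\le n$ means that for every entourage $E$ of $X$ there are $n+1$ uniformly bounded families of subsets of $X$ that together cover $X$, such that in each family $(U\times V)\cap E=\emptyset$ for all distinct members $U$, $V$.) -/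

import Mathlib

open Filter Topology

/-- A (connected) coarse structure on a set `X`. -/
structure CoarseStructure (X : Type*) where
  /-- The family of entourages. -/
  entourages : Set (Set (X × X))
  diag_mem : ∀ E ∈ entourages, ∀ x : X, (x, x) ∈ E
  comp_mem : ∀ E ∈ entourages, ∀ E' ∈ entourages,
    {p : X × X | ∃ z, (p.1, z) ∈ E ∧ (z, p.2) ∈ E'} ∈ entourages
  inv_mem : ∀ E ∈ entourages, {p : X × X | (p.2, p.1) ∈ E} ∈ entourages
  mono_mem : ∀ E ∈ entourages, ∀ E' : Set (X × X), (∀ x : X, (x, x) ∈ E') → E' ⊆ E →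
    E' ∈ entourages
  connected : ∀ x y : X, ∃ E ∈ entourages, (x, y) ∈ E

namespace CoarseStructure

/-- The ball `E[x]` of radius `E` around `x`. -/
def ball {X : Type*} (E : Set (X × X)) (x : X) : Set X := {y | (x, y) ∈ E}

/-- The coarse structure induced on a subset `Y`: its entourages are the traces `E ∩ (Y × Y)`. -/
def subspace {X : Type*} (C : CoarseStructure X) (Y : Set X) : CoarseStructure Y where
  entourages := {E | ∃ E' ∈ C.entourages, E = {p : Y × Y | ((p.1 : X), (p.2 : X)) ∈ E'}}
  diag_mem := by
    rintro _ ⟨E', hE', rfl⟩ x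
    exact C.diag_mem E' hE' x
  comp_mem := by
    rintro _ ⟨E, hE, rfl⟩ _ ⟨F, hF, rfl⟩
    refine ⟨{p : X × X | (∃ z ∈ Y, (p.1, z) ∈ E ∧ (z, p.2) ∈ F) ∨ p.1 = p.2}, ?_, ?_⟩
    · refine C.mono_mem _ (C.comp_mem E hE F hF) _ (fun x => Or.inr rfl) ?_
      rintro ⟨x, y⟩ (⟨z, -, h⟩ | h)
      · exact ⟨z, h⟩
      · obtain rfl : x = y := h
        exact ⟨x, C.diag_mem E hE x, C.diag_mem F hF x⟩
    · ext ⟨x, y⟩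
      constructor
      · rintro ⟨z, h⟩
        exact Or.inl ⟨z, z.2, h⟩
      · rintro (⟨z, hz, h⟩ | h)
        · exact ⟨⟨z, hz⟩, h⟩
        · obtain rfl : x = y := Subtype.ext h
          exact ⟨x, C.diag_mem E hE x, C.diag_mem F hF x⟩
  inv_mem := by
    rintro _ ⟨E, hE, rfl⟩
    exact ⟨_, C.inv_mem E hE, rfl⟩
  mono_mem := by
    rintro _ ⟨E, hE, rfl⟩ E' hd hsub
    refine ⟨{p : X × X | (∃ q ∈ E', p = ((q.1 : X), (q.2 : X))) ∨ p.1 = p.2}, ?_, ?_⟩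
    · refine C.mono_mem E hE _ (fun x => Or.inr rfl) ?_
      rintro ⟨x, y⟩ (⟨q, hq, h⟩ | h)
      · rw [h]
        exact hsub hq
      · obtain rfl : x = y := h
        exact C.diag_mem E hE x
    · ext ⟨x, y⟩
      constructor
      · intro h
        exact Or.inl ⟨(x, y), h, rfl⟩
      · rintro (⟨⟨u, v⟩, hq, h⟩ | h)
        · obtain ⟨h1, h2⟩ := Prod.mk.inj h
          obtain rfl := Subtype.ext h1
          obtain rfl := Subtype.ext h2
          exact hq
        · obtain rfl : x = y := Subtype.ext h
          exact hd x
  connected := by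
    intro x y
    obtain ⟨E, hE, h⟩ := C.connected x y
    exact ⟨_, ⟨E, hE, rfl⟩, h⟩

/-- `f` is macro-uniform: each entourage `E` admits an entourage `E'` with
`f (E[x]) ⊆ E'[f x]` for all `x`. -/
def MacroUniform {X Y : Type*} (C : CoarseStructure X) (D : CoarseStructure Y) (f : X → Y) :
    Prop :=
  ∀ E ∈ C.entourages, ∃ E' ∈ D.entourages, ∀ x : X, f '' ball E x ⊆ ball E' (f x)

/-- A bijection that is macro-uniform in both directions. -/
def IsAsymorphism {X Y : Type*} (C : CoarseStructure X) (D : CoarseStructure Y) (f : X ≃ Y) :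
    Prop :=
  MacroUniform C D f ∧ MacroUniform D C f.symm

/-- The sets of the family `𝒰` are uniformly bounded. -/
def UniformlyBounded {X : Type*} (C : CoarseStructure X) (𝒰 : Set (Set X)) : Prop :=
  ∃ D ∈ C.entourages, ∀ U ∈ 𝒰, ∀ x ∈ U, ∀ y ∈ U, (x, y) ∈ D

/-- Distinct members of the family `𝒰` are `E`-disjoint. -/
def EDisjoint {X : Type*} (E : Set (X × X)) (𝒰 : Set (Set X)) : Prop :=
  ∀ U ∈ 𝒰, ∀ V ∈ 𝒰, U ≠ V → ∀ x ∈ U, ∀ y ∈ V, (x, y) ∉ E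

/-- `asdim ≤ n`: for each entourage `E`, the space is covered by `n + 1` uniformly bounded
`E`-disjoint families. -/
def AsdimLE {X : Type*} (C : CoarseStructure X) (n : ℕ) : Prop :=
  ∀ E ∈ C.entourages, ∃ 𝒰 : Fin (n + 1) → Set (Set X),
    (∀ x : X, ∃ i, ∃ U ∈ 𝒰 i, x ∈ U) ∧
    (∀ i, C.UniformlyBounded (𝒰 i)) ∧ (∀ i, EDisjoint E (𝒰 i))

/-- The asymptotic dimension: the least `n` with `asdim ≤ n`, and `⊤` if there is none. -/
noncomputable def asdim {X : Type*} (C : CoarseStructure X) : ℕ∞ :=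
  ⨅ (n : ℕ) (_ : C.AsdimLE n), (n : ℕ∞)

end CoarseStructure

/-- The Hamming space: finite subsets of `ℕ` with the coarse structure of the metric
`(F, H) ↦ |F ∆ H|`. -/
def hammingSpace : CoarseStructure (Finset ℕ) where
  entourages := {E | (∀ F, (F, F) ∈ E) ∧ ∃ n : ℕ, ∀ p ∈ E, (symmDiff p.1 p.2).card ≤ n}
  diag_mem := fun _ hE => hE.1
  comp_mem := by
    rintro E ⟨hE, m, hm⟩ E' ⟨hE', n, hn⟩
    refine ⟨fun F => ⟨F, hE F, hE' F⟩, m + n, ?_⟩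
    rintro ⟨F, H⟩ ⟨K, h1, h2⟩
    calc (symmDiff F H).card ≤ (symmDiff F K ∪ symmDiff K H).card :=
          Finset.card_le_card (symmDiff_triangle F K H)
      _ ≤ (symmDiff F K).card + (symmDiff K H).card := Finset.card_union_le _ _
      _ ≤ m + n := Nat.add_le_add (hm _ h1) (hn _ h2)
  inv_mem := by
    rintro E ⟨hE, m, hm⟩
    refine ⟨hE, m, fun p hp => ?_⟩
    rw [symmDiff_comm]
    exact hm _ hp
  mono_mem := by
    rintro E ⟨_, m, hm⟩ E' hd hsub
    exact ⟨hd, m, fun p hp => hm p (hsub hp)⟩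
  connected := by
    intro F H
    refine ⟨{p | p.1 = p.2 ∨ p = (F, H)}, ⟨fun _ => Or.inl rfl, (symmDiff F H).card, ?_⟩,
      Or.inr rfl⟩
    rintro ⟨K, L⟩ (h | h)
    · obtain rfl : K = L := h
      simp
    · obtain ⟨rfl, rfl⟩ := Prod.mk.inj h
      exact le_rfl

/-- A group ideal on an Abelian group. -/
structure AddGroupIdeal (G : Type*) [AddCommGroup G] where
  /-- The members of the ideal. -/
  sets : Set (Set G)
  finite_mem : ∀ S : Set G, S.Finite → S ∈ sets
  sub_mem : ∀ S ∈ sets, ∀ T ∈ sets, {g : G | ∃ s ∈ S, ∃ t ∈ T, g = s - t} ∈ sets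
  subset_mem : ∀ S ∈ sets, ∀ T ⊆ S, T ∈ sets

/-- The coarse group `(G, I)`: the entourages are the reflexive relations contained in
`{(x, y) | x - y ∈ P}` for some `P ∈ I`. -/
def AddGroupIdeal.coarseGroup {G : Type*} [AddCommGroup G] (I : AddGroupIdeal G) :
    CoarseStructure G where
  entourages := {E | (∀ x, (x, x) ∈ E) ∧ ∃ P ∈ I.sets, ∀ p ∈ E, p.1 - p.2 ∈ P}
  diag_mem := fun _ hE => hE.1
  comp_mem := by
    rintro E ⟨hE, P, hP, hEP⟩ E' ⟨hE', Q, hQ, hEQ⟩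
    refine ⟨fun x => ⟨x, hE x, hE' x⟩, _,
      I.sub_mem P hP _ (I.sub_mem {0} (I.finite_mem _ (Set.finite_singleton 0)) Q hQ), ?_⟩
    rintro ⟨x, y⟩ ⟨z, h1, h2⟩
    exact ⟨x - z, hEP _ h1, 0 - (z - y), ⟨0, rfl, z - y, hEQ _ h2, rfl⟩, by simp⟩
  inv_mem := by
    rintro E ⟨hE, P, hP, hEP⟩
    refine ⟨hE, _, I.sub_mem {0} (I.finite_mem _ (Set.finite_singleton 0)) P hP, ?_⟩
    rintro ⟨x, y⟩ h
    exact ⟨0, rfl, y - x, hEP _ h, by simp⟩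
  mono_mem := by
    rintro E ⟨_, P, hP, hEP⟩ E' hd hsub
    exact ⟨hd, P, hP, fun p hp => hEP p (hsub hp)⟩
  connected := by
    intro x y
    refine ⟨{p | p.1 - p.2 ∈ ({0, x - y} : Set G)}, ⟨fun z => by simp, {0, x - y}, ?_,
      fun _ hp => hp⟩, by simp⟩
    exact I.finite_mem _ ((Set.finite_singleton _).insert _)

/-- The ideal of precompact subsets (those with compact closure) of an Abelian topological
group. -/
def AddGroupIdeal.precompact {G : Type*} [AddCommGroup G] (t : AddGroupTopology G) :
    AddGroupIdeal G where
  sets := {S | @IsCompact G t.toTopologicalSpace (@closure G t.toTopologicalSpace S)}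
  finite_mem := by
    let _ := t.toTopologicalSpace
    have := t.toIsTopologicalAddGroup
    intro S hS
    exact hS.isCompact.closure
  sub_mem := by
    let _ := t.toTopologicalSpace
    have := t.toIsTopologicalAddGroup
    intro S hS T hT
    have hK : IsCompact ((fun p : G × G => p.1 - p.2) '' (closure S ×ˢ closure T)) :=
      (IsCompact.prod hS hT).image continuous_sub
    refine hK.closure_of_subset ?_
    rintro _ ⟨s, hs, u, hu, rfl⟩
    exact ⟨(s, u), ⟨subset_closure hs, subset_closure hu⟩, rfl⟩
  subset_mem := by
    let _ := t.toTopologicalSpace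
    intro S hS T hTS
    exact IsCompact.of_isClosed_subset hS isClosed_closure (closure_mono hTS)

/-- The sequence `a` converges to `0` in the group topology `t`. -/
def ConvergesToZero {G : Type*} [AddCommGroup G] (t : AddGroupTopology G) (a : ℕ → G) : Prop :=
  Tendsto a atTop (@nhds G t.toTopologicalSpace 0)

/-- `a` is a T-sequence: it converges to `0` in some Hausdorff group topology. -/
def IsTSequence {G : Type*} [AddCommGroup G] (a : ℕ → G) : Prop :=
  ∃ t : AddGroupTopology G, @T2Space G t.toTopologicalSpace ∧ ConvergesToZero t a

/-- `a` is trivial: `a n = 0` for all but finitely many `n`. -/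
def IsTrivialSequence {G : Type*} [AddCommGroup G] (a : ℕ → G) : Prop :=
  {n | a n ≠ 0}.Finite

/-- The strongest group topology in which `a` converges to `0`. In Mathlib's order, stronger
(finer) topologies are smaller. -/
def strongestTopology {G : Type*} [AddCommGroup G] (a : ℕ → G) : AddGroupTopology G :=
  sInf {t | ConvergesToZero t a}

/-- The infimum defining `strongestTopology` is attained. -/
theorem isLeast_strongestTopology {G : Type*} [AddCommGroup G] (a : ℕ → G) :
    IsLeast {t | ConvergesToZero t a} (strongestTopology a) := by
  refine ⟨?_, fun t ht => sInf_le ht⟩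
  change Tendsto a atTop (@nhds G (sInf (AddGroupTopology.toTopologicalSpace '' _)) 0)
  rw [nhds_sInf]
  simp only [tendsto_iInf]
  rintro _ ⟨t, ht, rfl⟩
  exact ht

/-- The coarse group of `G` with the ideal of all precompact subsets of `G` in the strongest
group topology in which `a` converges to `0`. -/
def coarseGroupOfSeq {G : Type*} [AddCommGroup G] (a : ℕ → G) : CoarseStructure G :=
  (AddGroupIdeal.precompact (strongestTopology a)).coarseGroup

/-- The set of sums of `b` over finite sets of indices (the empty set included). -/
def finiteSums {G : Type*} [AddCommGroup G] (b : ℕ → G) : Set G :=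
  Set.range fun F : Finset ℕ => ∑ i ∈ F, b i

/-- Sums of `b` over distinct finite index sets are distinct. -/
def FSStrict {G : Type*} [AddCommGroup G] (b : ℕ → G) : Prop :=
  ∀ H F : Finset ℕ, ∑ i ∈ H, b i = ∑ i ∈ F, b i → F = H

/-! Let `T = signedTail a 0` be the set of `0` and all `± a i`. In the strongest topology `T` is
compact, hence so is each `n • T`. The sums over two index sets at Hamming distance `n` differ by an
element of `n • T`, so the sum map is macro-uniform.

For the inverse two facts are needed. First, a precompact set of finite signed sums lies in a single
`n • T` (`exists_subset_nsmul_of_isCompact_closure`). Otherwise it contains an infinite set meeting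
every `n • T` in a finite set; this set has an accumulation point, yet its translate by that point
misses, apart from `0`, a neighbourhood `tailSums a n` built one summand at a time. Second, along a
sparse subsequence a signed sum of `n` distinct terms never lies in `k • T` with `k < n`
(`card_le_of_sum_mem_nsmul`). The reason is that accumulation points of `(n + 1) • T` lie in `n • T`
(`mem_nsmul_of_accPt`), so if `s ∉ n • T`, then adding a late nonzero term to `s` leaves `(n + 1) •
T`.

A double count in finite cubes shows that the Hamming space has infinite asymptotic dimension
(`not_asdimLE_hammingSpace`), and covers pull back along the sum map. -/

open scoped Pointwise

/-! ### Signed sums and neighbourhoods of zero -/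

section SignedSums

variable {G : Type*} [AddCommGroup G]

/-- The set consisting of `0` and of the elements `± a i` with `m ≤ i`. -/
def signedTail (a : ℕ → G) (m : ℕ) : Set G :=
  {x | x = 0 ∨ ∃ i, m ≤ i ∧ (x = a i ∨ x = -a i)}

theorem zero_mem_signedTail (a : ℕ → G) (m : ℕ) : 0 ∈ signedTail a m := Or.inl rfl

theorem signedTail_antitone (a : ℕ → G) : Antitone (signedTail a) := by
  rintro m n h x (rfl | ⟨i, hi, hx⟩)
  · exact Or.inl rfl
  · exact Or.inr ⟨i, h.trans hi, hx⟩

theorem neg_mem_signedTail {a : ℕ → G} {m : ℕ} {x : G} (hx : x ∈ signedTail a m) :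
    -x ∈ signedTail a m := by
  rcases hx with rfl | ⟨i, hi, rfl | rfl⟩
  · exact Or.inl neg_zero
  · exact Or.inr ⟨i, hi, Or.inr rfl⟩
  · exact Or.inr ⟨i, hi, Or.inl (neg_neg _)⟩

theorem neg_mem_nsmul_signedTail {a : ℕ → G} {m n : ℕ} {x : G} (hx : x ∈ n • signedTail a m) :
    -x ∈ n • signedTail a m := by
  induction n generalizing x with
  | zero =>
    rw [zero_smul, Set.mem_zero] at hx ⊢
    rw [hx, neg_zero]
  | succ n ih =>
    rw [succ_nsmul] at hx ⊢
    obtain ⟨u, hu, v, hv, rfl⟩ := hx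
    exact ⟨-u, ih hu, -v, neg_mem_signedTail hv, by simp only [neg_add]⟩

theorem nsmul_signedTail_mono (a : ℕ → G) (m : ℕ) : Monotone fun n : ℕ => n • signedTail a m :=
  fun _ _ h => Set.nsmul_subset_nsmul_right (zero_mem_signedTail a m) h

theorem sum_mem_nsmul_of_mem {ι : Type*} {A : Set G} {c : ι → G} (K : Finset ι)
    (hc : ∀ i ∈ K, c i ∈ A) : ∑ i ∈ K, c i ∈ K.card • A := by
  have := Set.finsetSum_mem_finsetSum K (fun _ => A) c hc
  simpa using this

/-- The union over `k` of the sums `signedTail a (n 0) + ⋯ + signedTail a (n (k - 1))`. -/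
def tailSums (a : ℕ → G) (n : ℕ → ℕ) : Set G :=
  ⋃ k : ℕ, ∑ j ∈ Finset.range k, signedTail a (n j)

theorem zero_mem_tailSums (a : ℕ → G) (n : ℕ → ℕ) : 0 ∈ tailSums a n :=
  Set.mem_iUnion.2 ⟨0, by simp⟩

theorem tailSums_anti (a : ℕ → G) {n n' : ℕ → ℕ} (h : n ≤ n') : tailSums a n' ⊆ tailSums a n :=
  Set.iUnion_mono fun _ => Set.finsetSum_subset_finsetSum _ _ _
    fun j _ => signedTail_antitone a (h j)

theorem sum_signedTail_mono (a : ℕ → G) (n : ℕ → ℕ) :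
    Monotone fun k => ∑ j ∈ Finset.range k, signedTail a (n j) := by
  refine monotone_nat_of_le_succ fun k x hx => ?_
  rw [Finset.sum_range_succ]
  exact ⟨x, hx, 0, zero_mem_signedTail a _, add_zero x⟩

theorem sum_range_two_mul_signedTail (a : ℕ → G) (n : ℕ → ℕ) (k : ℕ) :
    ∑ j ∈ Finset.range (2 * k), signedTail a (n j) =
      ∑ j ∈ Finset.range k, (signedTail a (n (2 * j)) + signedTail a (n (2 * j + 1))) := by
  induction k with
  | zero => simp
  | succ k ih =>
    rw [Finset.sum_range_succ, ← ih, mul_add, mul_one, Finset.sum_range_succ,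
      Finset.sum_range_succ, add_assoc]

/-- Interleaving: the summands of one element go to the even positions, those of the other to the
odd ones. The maximum makes each summand small enough for either position. -/
theorem tailSums_add_subset (a : ℕ → G) (n : ℕ → ℕ) :
    tailSums a (fun j => max (n (2 * j)) (n (2 * j + 1))) +
      tailSums a (fun j => max (n (2 * j)) (n (2 * j + 1))) ⊆ tailSums a n := by
  rintro _ ⟨x, hx, y, hy, rfl⟩
  obtain ⟨k, hx⟩ := Set.mem_iUnion.1 hx
  obtain ⟨l, hy⟩ := Set.mem_iUnion.1 hy
  have hx := sum_signedTail_mono a _ (le_max_left k l) hx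
  have hy := sum_signedTail_mono a _ (le_max_right k l) hy
  refine Set.mem_iUnion.2 ⟨2 * max k l, ?_⟩
  rw [sum_range_two_mul_signedTail, Finset.sum_add_distrib]
  exact Set.add_mem_add
    (Set.finsetSum_subset_finsetSum _ _ _
      (fun j _ => signedTail_antitone a (le_max_left (n (2 * j)) (n (2 * j + 1)))) hx)
    (Set.finsetSum_subset_finsetSum _ _ _
      (fun j _ => signedTail_antitone a (le_max_right (n (2 * j)) (n (2 * j + 1)))) hy)

theorem neg_mem_tailSums {a : ℕ → G} {n : ℕ → ℕ} {x : G} (hx : x ∈ tailSums a n) :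
    -x ∈ tailSums a n := by
  obtain ⟨k, hx⟩ := Set.mem_iUnion.1 hx
  refine Set.mem_iUnion.2 ⟨k, ?_⟩
  obtain ⟨g, hg, rfl⟩ := Set.mem_finsetSum _ _ _ |>.1 hx
  rw [← Finset.sum_neg_distrib]
  exact Set.finsetSum_mem_finsetSum _ _ _ fun i hi => neg_mem_signedTail (hg hi)

/-- The sets `tailSums a n` form a basis of neighbourhoods of zero of a group topology. -/
abbrev tailSumsBasis (a : ℕ → G) : AddGroupFilterBasis G where
  sets := Set.range (tailSums a)
  nonempty := Set.range_nonempty _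
  inter_sets := by
    rintro _ _ ⟨n, rfl⟩ ⟨n', rfl⟩
    exact ⟨_, ⟨n ⊔ n', rfl⟩,
      Set.subset_inter (tailSums_anti a le_sup_left) (tailSums_anti a le_sup_right)⟩
  zero' := by
    rintro _ ⟨n, rfl⟩
    exact zero_mem_tailSums a n
  add' := by
    rintro _ ⟨n, rfl⟩
    exact ⟨_, ⟨_, rfl⟩, tailSums_add_subset a n⟩
  neg' := by
    rintro _ ⟨n, rfl⟩
    exact ⟨_, ⟨n, rfl⟩, fun x hx => neg_mem_tailSums hx⟩
  conj' := by
    rintro x₀ _ ⟨n, rfl⟩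
    refine ⟨_, ⟨n, rfl⟩, fun x hx => ?_⟩
    simpa using hx

/-- The basis `tailSumsBasis a` defines a group topology in which `a` tends to `0`, and the
strongest such topology refines it. -/
theorem tailSums_mem_nhds_zero (a : ℕ → G) (n : ℕ → ℕ) :
    tailSums a n ∈ @nhds G (strongestTopology a).toTopologicalSpace 0 := by
  let t : AddGroupTopology G := ⟨(tailSumsBasis a).topology, (tailSumsBasis a).isTopologicalAddGroup⟩
  have hb : (@nhds G t.toTopologicalSpace 0).HasBasis (fun V => V ∈ tailSumsBasis a) id :=
    (tailSumsBasis a).nhds_zero_hasBasis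
  have ht : ConvergesToZero t a := by
    refine hb.tendsto_right_iff.2 ?_
    rintro _ ⟨n, rfl⟩
    filter_upwards [eventually_ge_atTop (n 0)] with i hi
    refine Set.mem_iUnion.2 ⟨1, ?_⟩
    rw [Finset.sum_range_one]
    exact Or.inr ⟨i, hi, Or.inl rfl⟩
  have hle : (strongestTopology a).toTopologicalSpace ≤ t.toTopologicalSpace :=
    (isLeast_strongestTopology a).2 ht
  exact nhds_mono hle (hb.mem_of_mem (i := tailSums a n) ⟨n, rfl⟩)

end SignedSums

/-! ### Accumulation points and compact sets of signed sums -/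

/-- An ultrafilter on `A + B` that converges to `s` but avoids `s` lifts to `A ×ˢ B`, where
compactness gives a limit `(u, v)` with `u + v = s`. Since the sums avoid `s`, one coordinate avoids
its own limit on a set of the ultrafilter. -/
theorem IsCompact.accPt_add {G : Type*} [TopologicalSpace G] [Add G] [ContinuousAdd G]
    [T2Space G] {A B : Set G} (hA : IsCompact A) (hB : IsCompact B) {s : G}
    (hs : AccPt s (𝓟 (A + B))) :
    (∃ u, AccPt u (𝓟 A) ∧ ∃ v ∈ B, u + v = s) ∨ ∃ u ∈ A, ∃ v, AccPt v (𝓟 B) ∧ u + v = s := by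
  have : NeBot (𝓝[≠] s ⊓ 𝓟 (A + B)) := hs
  set g : Ultrafilter G := Ultrafilter.of (𝓝[≠] s ⊓ 𝓟 (A + B))
  have hg : (g : Filter G) ≤ 𝓝[≠] s ⊓ 𝓟 (A + B) := Ultrafilter.of_le _
  have hmem : (fun p : G × G => p.1 + p.2) '' (A ×ˢ B) ∈ g := by
    rw [Set.add_image_prod]
    exact le_principal_iff.1 (hg.trans inf_le_right)
  set w := Ultrafilter.ofComapInfPrincipal hmem
  have hw : w.map (fun p : G × G => p.1 + p.2) = g := Ultrafilter.ofComapInfPrincipal_eq_of_map hmem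
  have hAB : A ×ˢ B ∈ w := Ultrafilter.ofComapInfPrincipal_mem hmem
  have hA' : ∀ᶠ p in (w : Filter (G × G)), p.1 ∈ A := mem_of_superset hAB fun p hp => hp.1
  have hB' : ∀ᶠ p in (w : Filter (G × G)), p.2 ∈ B := mem_of_superset hAB fun p hp => hp.2
  obtain ⟨u, hu, hwu⟩ := hA.ultrafilter_le_nhds (w.map Prod.fst) (le_principal_iff.2 hA')
  obtain ⟨v, hv, hwv⟩ := hB.ultrafilter_le_nhds (w.map Prod.snd) (le_principal_iff.2 hB')
  have hwu : Tendsto Prod.fst (w : Filter (G × G)) (𝓝 u) := hwu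
  have hwv : Tendsto Prod.snd (w : Filter (G × G)) (𝓝 v) := hwv
  have hws : Tendsto (fun p : G × G => p.1 + p.2) (w : Filter (G × G)) (𝓝[≠] s) := by
    have : ((w.map (fun p : G × G => p.1 + p.2) : Ultrafilter G) : Filter G) ≤ 𝓝[≠] s := by
      rw [hw]; exact hg.trans inf_le_left
    exact this
  have huv : u + v = s := tendsto_nhds_unique (hwu.add hwv) (hws.mono_right nhdsWithin_le_nhds)
  have key : ∀ᶠ p in (w : Filter (G × G)), p.1 ≠ u ∨ p.2 ≠ v := by
    have : ∀ᶠ p in (w : Filter (G × G)), p.1 + p.2 ≠ s := hws.eventually self_mem_nhdsWithin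
    filter_upwards [this] with p hp
    by_contra! h
    exact hp (by rw [h.1, h.2, huv])
  rcases Ultrafilter.eventually_or.1 key with h | h
  · refine Or.inl ⟨u, ?_, v, hv, huv⟩
    rw [accPt_iff_frequently]
    exact hwu.frequently (h.and hA').frequently
  · refine Or.inr ⟨u, hu, v, ?_, huv⟩
    rw [accPt_iff_frequently]
    exact hwv.frequently (h.and hB').frequently

section Topological

variable {G : Type*} [AddCommGroup G] [TopologicalSpace G] [IsTopologicalAddGroup G]
  {a : ℕ → G}

theorem isCompact_signedTail (ha : Tendsto a atTop (𝓝 0)) (m : ℕ) :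
    IsCompact (signedTail a m) := by
  have hT : IsCompact (insert 0 (Set.range fun i => a (i + m))) :=
    ((tendsto_add_atTop_iff_nat m).2 ha).isCompact_insert_range
  convert hT.union hT.neg using 1
  ext x
  constructor
  · rintro (rfl | ⟨i, hi, rfl | rfl⟩)
    · exact Or.inl (Or.inl rfl)
    · exact Or.inl (Or.inr ⟨i - m, by simp [hi]⟩)
    · exact Or.inr (Set.mem_neg.2 (Or.inr ⟨i - m, by simp [hi]⟩))
  · rintro ((rfl | ⟨i, rfl⟩) | hx)
    · exact Or.inl rfl
    · exact Or.inr ⟨i + m, by omega, Or.inl rfl⟩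
    · rcases Set.mem_neg.1 hx with h | ⟨i, h⟩
      · exact Or.inl (neg_eq_zero.1 h)
      · exact Or.inr ⟨i + m, by omega, Or.inr (by simp [h])⟩

theorem isCompact_nsmul_signedTail (ha : Tendsto a atTop (𝓝 0)) (m n : ℕ) :
    IsCompact (n • signedTail a m) := by
  induction n with
  | zero => rw [zero_smul]; exact isCompact_singleton
  | succ n ih => rw [succ_nsmul]; exact ih.add (isCompact_signedTail ha m)

variable [T2Space G]

theorem eq_zero_of_accPt_signedTail (ha : Tendsto a atTop (𝓝 0)) {m : ℕ} {s : G}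
    (hs : AccPt s (𝓟 (signedTail a m))) : s = 0 := by
  by_contra h0
  obtain ⟨U, W, hU, hW, hUW⟩ := t2_separation_nhds h0
  have ha' : Tendsto (fun i => -a i) atTop (𝓝 0) := by simpa using ha.neg
  obtain ⟨N, hN⟩ := eventually_atTop.1 ((ha.eventually hW).and (ha'.eventually hW))
  have hF : (⋃ i ∈ Finset.range N, {a i, -a i} : Set G).Finite :=
    (Finset.range N).finite_toSet.biUnion fun i _ => ((Set.finite_singleton _).insert _)
  have hF' := hF.subset (Set.sdiff_subset (t := {s}))
  rw [accPt_iff_frequently] at hs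
  refine hs ?_
  filter_upwards [hU, hF'.isClosed.compl_mem_nhds (fun h => h.2 rfl)] with y hyU hyF hy
  have hyW : y ∉ W := fun h => Set.disjoint_left.1 hUW hyU h
  rcases hy.2 with rfl | ⟨i, -, hi⟩
  · exact hyW (mem_of_mem_nhds hW)
  · rcases lt_or_ge i N with hiN | hiN
    · refine hyF ⟨?_, hy.1⟩
      simp only [Finset.mem_range, Set.mem_iUnion]
      exact ⟨i, hiN, hi⟩
    · rcases hi with rfl | rfl
      · exact hyW (hN i hiN).1
      · exact hyW (hN i hiN).2

/-- Passing to accumulation points shortens a sum: by `IsCompact.accPt_add` some summand must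
accumulate at its limit, and a single summand can do so only at `0`. -/
theorem mem_nsmul_of_accPt (ha : Tendsto a atTop (𝓝 0)) {m n : ℕ} {s : G}
    (hs : AccPt s (𝓟 ((n + 1) • signedTail a m))) : s ∈ n • signedTail a m := by
  induction n generalizing s with
  | zero =>
    rw [zero_add, one_smul] at hs
    rw [zero_smul, Set.mem_zero]
    exact eq_zero_of_accPt_signedTail ha hs
  | succ n ih =>
    rw [succ_nsmul] at hs
    rcases (isCompact_nsmul_signedTail ha m (n + 1)).accPt_add (isCompact_signedTail ha m) hs
      with ⟨u, hu, v, hv, rfl⟩ | ⟨u, hu, v, hv, rfl⟩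
    · rw [succ_nsmul]
      exact Set.add_mem_add (ih hu) hv
    · rw [eq_zero_of_accPt_signedTail ha hv, add_zero]
      exact hu

theorem eventually_add_notMem_nsmul (ha : Tendsto a atTop (𝓝 0)) {n : ℕ} {s : G}
    (hs : s ∉ n • signedTail a 0) :
    ∀ᶠ m in atTop, a m ≠ 0 →
      s + a m ∉ (n + 1) • signedTail a 0 ∧ s - a m ∉ (n + 1) • signedTail a 0 := by
  -- The point `s` itself may lie in `(n + 1) • signedTail a 0`, hence the punctured form and the
  -- condition `a m ≠ 0`.
  have h : ∀ᶠ y in 𝓝 s, ¬ (y ≠ s ∧ y ∈ (n + 1) • signedTail a 0) := by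
    by_contra h
    exact hs (mem_nsmul_of_accPt ha (accPt_iff_frequently.2 h))
  have h1 : Tendsto (fun m => s + a m) atTop (𝓝 s) := by simpa using tendsto_const_nhds.add ha
  have h2 : Tendsto (fun m => s - a m) atTop (𝓝 s) := by simpa using tendsto_const_nhds.sub ha
  filter_upwards [h1.eventually h, h2.eventually h] with m hm1 hm2 hne
  exact ⟨fun hm => hm1 ⟨by simpa using hne, hm⟩, fun hm => hm2 ⟨by simpa using hne, hm⟩⟩

/-- A set that meets all the sets `k • signedTail a 0` in finite sets has no nonzero elements in
some basic neighbourhood of zero. -/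
theorem exists_tailSums_inter_subset (ha : Tendsto a atTop (𝓝 0)) {D : Set G}
    (hD : ∀ k : ℕ, (D ∩ k • signedTail a 0).Finite) :
    ∃ n : ℕ → ℕ, tailSums a n ∩ D ⊆ {0} := by
  -- One more tail can be added to a good compact set `K`. The implication sits inside the
  -- existential so that `choose` gives a function of all `k` and `K`.
  have step : ∀ (k : ℕ) (K : Set G), ∃ m : ℕ,
      (IsCompact K ∧ K ⊆ k • signedTail a 0 ∧ K ∩ D ⊆ {0}) →
      (IsCompact (K + signedTail a m) ∧ K + signedTail a m ⊆ (k + 1) • signedTail a 0 ∧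
        (K + signedTail a m) ∩ D ⊆ {0}) := by
    intro k K
    by_cases hK : IsCompact K ∧ K ⊆ k • signedTail a 0 ∧ K ∩ D ⊆ {0}
    swap
    · exact ⟨0, fun h => absurd h hK⟩
    obtain ⟨hc, hk, hKD⟩ := hK
    -- Only these finitely many `d` could enter the enlarged sum. A nonzero one lies off the closed
    -- set `K`, so `d ± a i` also lies off `K` for late `i`.
    have hev : ∀ d ∈ D ∩ (k + 1) • signedTail a 0,
        ∀ᶠ m in atTop, d ≠ 0 → d ∉ K + signedTail a m := by
      intro d hd
      by_cases h0 : d = 0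
      · exact Eventually.of_forall fun _ h => absurd h0 h
      have hdK : d ∉ K := fun h => h0 (hKD ⟨h, hd.1⟩)
      have hnhds : Kᶜ ∈ 𝓝 d := hc.isClosed.compl_mem_nhds hdK
      have h1 : Tendsto (fun m => d + a m) atTop (𝓝 d) := by
        simpa using tendsto_const_nhds.add ha
      have h2 : Tendsto (fun m => d - a m) atTop (𝓝 d) := by
        simpa using tendsto_const_nhds.sub ha
      obtain ⟨N, hN⟩ := eventually_atTop.1 ((h1.eventually hnhds).and (h2.eventually hnhds))
      filter_upwards [eventually_ge_atTop N] with m hm _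
      rintro ⟨u, hu, v, hv | ⟨i, hi, rfl | rfl⟩, huv⟩
      · simp only [hv, add_zero] at huv
        exact hdK (huv ▸ hu)
      · exact (hN i (hm.trans hi)).2 (by rw [← huv]; simpa using hu)
      · exact (hN i (hm.trans hi)).1 (by rw [← huv]; simpa using hu)
    obtain ⟨m, hm⟩ := ((hD (k + 1)).eventually_all.2 hev).exists
    have hsub : K + signedTail a m ⊆ (k + 1) • signedTail a 0 := by
      rw [succ_nsmul]
      exact Set.add_subset_add hk (signedTail_antitone a (Nat.zero_le m))
    refine ⟨m, fun _ => ⟨hc.add (isCompact_signedTail ha m), hsub, ?_⟩⟩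
    rintro d ⟨hd, hdD⟩
    by_contra h0
    exact hm d ⟨hdD, hsub hd⟩ h0 hd
  choose f hf using step
  let K : ℕ → Set G := fun k => Nat.rec {0} (fun k K => K + signedTail a (f k K)) k
  have hK : ∀ k, K k = ∑ j ∈ Finset.range k, signedTail a (f j (K j)) := by
    intro k
    induction k with
    | zero => rfl
    | succ k ih => rw [Finset.sum_range_succ, ← ih]
  have hgood : ∀ k, IsCompact (K k) ∧ K k ⊆ k • signedTail a 0 ∧ K k ∩ D ⊆ {0} := by
    intro k
    induction k with
    | zero =>
      refine ⟨isCompact_singleton, ?_, Set.inter_subset_left⟩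
      rw [zero_smul]
      exact subset_rfl
    | succ k ih => exact hf k (K k) ih
  refine ⟨fun j => f j (K j), ?_⟩
  rintro x ⟨hx, hxD⟩
  obtain ⟨k, hk⟩ := Set.mem_iUnion.1 hx
  rw [← hK] at hk
  exact (hgood k).2.2 ⟨hk, hxD⟩

/-- A relatively compact set of finite signed sums consists of sums of bounded length. -/
theorem exists_subset_nsmul_of_isCompact_closure (ha : Tendsto a atTop (𝓝 0))
    (hnhds : ∀ n, tailSums a n ∈ 𝓝 (0 : G)) {P : Set G} (hP : IsCompact (closure P))
    (hPa : P ⊆ ⋃ n : ℕ, n • signedTail a 0) : ∃ n : ℕ, P ⊆ n • signedTail a 0 := by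
  by_contra! hcon
  have hcon : ∀ n : ℕ, ∃ d ∈ P, d ∉ n • signedTail a 0 := fun n => Set.not_subset.1 (hcon n)
  choose d hdP hd using hcon
  have hfin : ∀ n : ℕ, (Set.range d ∩ n • signedTail a 0).Finite := by
    intro n
    refine ((Set.finite_lt_nat n).image d).subset ?_
    rintro _ ⟨⟨k, rfl⟩, hk⟩
    refine ⟨k, lt_of_not_ge fun h => hd k (nsmul_signedTail_mono a 0 h hk), rfl⟩
  have hinf : (Set.range d).Infinite := by
    intro hF
    have : ∀ x ∈ Set.range d, ∀ᶠ n : ℕ in atTop, x ∈ n • signedTail a 0 := by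
      rintro _ ⟨k, rfl⟩
      obtain ⟨n, hn⟩ := Set.mem_iUnion.1 (hPa (hdP k))
      filter_upwards [eventually_ge_atTop n] with m hm
      exact nsmul_signedTail_mono a 0 hm hn
    obtain ⟨n, hn⟩ := (hF.eventually_all.2 this).exists
    exact hd n (hn _ ⟨n, rfl⟩)
  obtain ⟨x, -, hx⟩ := hinf.exists_accPt_of_subset_isCompact hP
    ((Set.range_subset_iff.2 hdP).trans subset_closure)
  -- Translation by `x` keeps the intersections finite: if `x` is a signed sum, lengths change by a
  -- bounded amount; if not, no `d k - x` is a signed sum.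
  have hfin' : ∀ n : ℕ, ((fun y => y - x) '' Set.range d ∩ n • signedTail a 0).Finite := by
    intro n
    by_cases hxM : ∃ M : ℕ, x ∈ M • signedTail a 0
    · obtain ⟨M, hM⟩ := hxM
      refine ((hfin (n + M)).image fun y => y - x).subset ?_
      rintro _ ⟨⟨y, hy, rfl⟩, hyn⟩
      refine ⟨y, ⟨hy, ?_⟩, rfl⟩
      rw [add_nsmul]
      exact ⟨y - x, hyn, x, hM, by simp⟩
    · convert Set.finite_empty
      refine Set.eq_empty_of_forall_notMem ?_
      rintro _ ⟨⟨y, ⟨k, rfl⟩, rfl⟩, hyn⟩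
      obtain ⟨l, hl⟩ := Set.mem_iUnion.1 (hPa (hdP k))
      refine hxM ⟨l + n, ?_⟩
      rw [add_nsmul]
      exact ⟨d k, hl, -(d k - x), neg_mem_nsmul_signedTail hyn, by simp⟩
  obtain ⟨n, hn⟩ := exists_tailSums_inter_subset ha hfin'
  rw [accPt_iff_frequently] at hx
  have hsub : Tendsto (fun y => y - x) (𝓝 x) (𝓝 0) := by
    simpa using (tendsto_id (α := G) (x := 𝓝 x)).sub_const x
  obtain ⟨y, ⟨hyx, hyd⟩, hy⟩ := (hx.and_eventually (hsub.eventually (hnhds n))).exists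
  exact hyx (sub_eq_zero.1 (hn ⟨hy, y, hyd, rfl⟩))

end Topological

/-! ### Infinite asymptotic dimension of the Hamming space -/

section HammingCube

/-- In a cube, a set covered by pairwise distant pieces of small radius is small. -/
theorem card_mul_le_of_centers (N d : ℕ) (X : Finset (Finset ℕ))
    (hX : X ⊆ (Finset.range N).powerset) (β : Finset ℕ → Finset ℕ)
    (hβ : ∀ F ∈ X, (symmDiff F (β F)).card ≤ d)
    (hX2 : ∀ F ∈ X, ∀ H ∈ X, (symmDiff F H).card ≤ 2 → β F = β H) :
    X.card * (N - d) ≤ 2 ^ N * (d + 1) := by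
  classical
  have hinv : ∀ F K : Finset ℕ, symmDiff (symmDiff F K) K = F := fun F K => by
    rw [symmDiff_assoc, symmDiff_self, Finset.bot_eq_empty, ← Finset.bot_eq_empty, symmDiff_bot]
  -- Double count of the pairs in which `H` is one step further than `F` from the centre `β F`. Each
  -- `F` has at least `N - d` such neighbours. All `F` paired with the same `H` are within distance
  -- 2, hence share a centre, and the flipped index lies in the at most `d + 1` elements of `H ∆ β
  -- F`.
  have h := Finset.card_mul_le_card_mul
    (r := fun F H : Finset ℕ => ∃ j, j ∉ symmDiff F (β F) ∧ H = symmDiff F {j})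
    (s := X) (t := (Finset.range N).powerset) (m := N - d) (n := d + 1) ?_ ?_
  · simpa using h
  · intro F hF
    have hsub : (Finset.range N \ symmDiff F (β F)).image (fun j => symmDiff F {j}) ⊆
        Finset.bipartiteAbove (fun F H : Finset ℕ => ∃ j, j ∉ symmDiff F (β F) ∧ H = symmDiff F {j})
          (Finset.range N).powerset F := by
      intro H hH
      obtain ⟨j, hj, rfl⟩ := Finset.mem_image.1 hH
      rw [Finset.mem_sdiff] at hj
      rw [Finset.mem_bipartiteAbove]
      refine ⟨Finset.mem_powerset.2 ?_, j, hj.2, rfl⟩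
      refine symmDiff_le_sup.trans (sup_le (Finset.mem_powerset.1 (hX hF)) ?_)
      simpa using hj.1
    refine le_trans ?_ (Finset.card_le_card hsub)
    rw [Finset.card_image_of_injective]
    · have := Finset.le_card_sdiff (symmDiff F (β F)) (Finset.range N)
      have h2 := hβ F hF
      rw [Finset.card_range] at this
      omega
    · intro i j hij
      exact Finset.singleton_injective (symmDiff_right_injective F hij)
  · intro H _
    rcases (Finset.bipartiteBelow (fun F H : Finset ℕ => ∃ j, j ∉ symmDiff F (β F) ∧
      H = symmDiff F {j}) X H).eq_empty_or_nonempty with h | ⟨F₀, hF₀⟩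
    · rw [h]; simp
    rw [Finset.mem_bipartiteBelow] at hF₀
    obtain ⟨hF₀, j₀, hj₀, hH⟩ := hF₀
    have hsub : Finset.bipartiteBelow (fun F H : Finset ℕ => ∃ j, j ∉ symmDiff F (β F) ∧
        H = symmDiff F {j}) X H ⊆ (symmDiff H (β F₀)).image (fun j => symmDiff H {j}) := by
      intro F hF
      rw [Finset.mem_bipartiteBelow] at hF
      obtain ⟨hF, j, hj, hHj⟩ := hF
      have hFF : β F = β F₀ := by
        refine hX2 F hF F₀ hF₀ ?_
        have h1 : symmDiff F F₀ ⊆ {j} ∪ {j₀} := by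
          intro i
          rw [← hinv F {j}, ← hHj, hH]
          simp only [Finset.mem_symmDiff, Finset.mem_singleton, Finset.mem_union]
          tauto
        exact (Finset.card_le_card h1).trans ((Finset.card_union_le _ _).trans (by simp))
      refine Finset.mem_image.2 ⟨j, ?_, ?_⟩
      · rw [← hFF, hHj]
        simp only [Finset.mem_symmDiff, Finset.mem_singleton] at hj ⊢
        tauto
      · simp only [hHj, hinv]
    refine (Finset.card_le_card hsub).trans (Finset.card_image_le.trans ?_)
    have h1 : symmDiff H (β F₀) ⊆ insert j₀ (symmDiff F₀ (β F₀)) := by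
      intro i
      rw [hH]
      simp only [Finset.mem_symmDiff, Finset.mem_singleton, Finset.mem_insert]
      tauto
    exact (Finset.card_le_card h1).trans
      ((Finset.card_insert_le _ _).trans (Nat.add_le_add_right (hβ F₀ hF₀) 1))

/-- Scale 2 already suffices: by `card_mul_le_of_centers` each family covers a fraction of at most
`(d + 1) / (N - d)` of the `N`-cube, so `n + 1` families cannot cover it for large `N`. -/
theorem not_asdimLE_hammingSpace (n : ℕ) : ¬ hammingSpace.AsdimLE n := by
  classical
  intro h
  obtain ⟨𝒰, hcov, hbdd, hdisj⟩ := h {p | (symmDiff p.1 p.2).card ≤ 2}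
    ⟨fun F => by simp, 2, fun p hp => hp⟩
  have hbdd' : ∀ i, ∃ d : ℕ, ∀ U ∈ 𝒰 i, ∀ F ∈ U, ∀ H ∈ U, (symmDiff F H).card ≤ d := by
    intro i
    obtain ⟨D, ⟨-, d, hd⟩, hD⟩ := hbdd i
    exact ⟨d, fun U hU F hF H hH => hd _ (hD U hU F hF H hH)⟩
  choose e he using hbdd'
  set d := Finset.univ.sup e
  -- Chosen so that `N - d` exceeds `(n + 1) * (d + 1)` by one.
  set N := d + (n + 1) * (d + 1) + 1 with hN
  let X : Fin (n + 1) → Finset (Finset ℕ) := fun i =>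
    (Finset.range N).powerset.filter fun F => ∃ U ∈ 𝒰 i, F ∈ U
  have hX : ∀ i, (X i).card * (N - d) ≤ 2 ^ N * (d + 1) := by
    intro i
    have hpiece : ∀ F, ∃ U, F ∈ X i → U ∈ 𝒰 i ∧ F ∈ U := by
      intro F
      by_cases hF : F ∈ X i
      · obtain ⟨U, hU⟩ := (Finset.mem_filter.1 hF).2
        exact ⟨U, fun _ => hU⟩
      · exact ⟨∅, fun h => absurd h hF⟩
    choose U hU using hpiece
    have hcenter : ∀ V : Set (Finset ℕ), ∃ c, V.Nonempty → c ∈ V := by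
      intro V
      by_cases hV : V.Nonempty
      · exact ⟨hV.some, fun h => hV.some_mem⟩
      · exact ⟨∅, fun h => absurd h hV⟩
    choose c hc using hcenter
    refine card_mul_le_of_centers N d (X i) (Finset.filter_subset _ _) (fun F => c (U F)) ?_ ?_
    · intro F hF
      obtain ⟨h1, h2⟩ := hU F hF
      exact (he i _ h1 F h2 _ (hc _ ⟨F, h2⟩)).trans (Finset.le_sup (f := e) (Finset.mem_univ i))
    · intro F hF H hH hFH
      by_contra hne
      exact hdisj i (U F) (hU F hF).1 (U H) (hU H hH).1 (fun h => hne (by simp only [h]))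
        F (hU F hF).2 H (hU H hH).2 hFH
  have hcard : 2 ^ N ≤ ∑ i, (X i).card := by
    have hsub : (Finset.range N).powerset ⊆ Finset.univ.biUnion X := by
      intro F hF
      obtain ⟨i, hi⟩ := hcov F
      exact Finset.mem_biUnion.2 ⟨i, Finset.mem_univ i, Finset.mem_filter.2 ⟨hF, hi⟩⟩
    have := (Finset.card_le_card hsub).trans Finset.card_biUnion_le
    simpa using this
  have hsum : (∑ i, (X i).card) * (N - d) ≤ (n + 1) * (2 ^ N * (d + 1)) := by
    rw [Finset.sum_mul]
    simpa using Finset.sum_le_sum fun i (_ : i ∈ Finset.univ) => hX i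
  have h1 : 2 ^ N * (N - d) ≤ 2 ^ N * ((n + 1) * (d + 1)) := by
    calc 2 ^ N * (N - d) ≤ (∑ i, (X i).card) * (N - d) := Nat.mul_le_mul_right _ hcard
      _ ≤ (n + 1) * (2 ^ N * (d + 1)) := hsum
      _ = _ := by ring
  have h2 := Nat.le_of_mul_le_mul_left h1 (by positivity)
  omega

end HammingCube

theorem CoarseStructure.AsdimLE.of_coarse_embedding {X Y : Type*} {C : CoarseStructure X}
    {D : CoarseStructure Y} {n : ℕ} (h : D.AsdimLE n) (f : X → Y)
    (hf : ∀ E ∈ C.entourages, ∃ E' ∈ D.entourages, ∀ p ∈ E, (f p.1, f p.2) ∈ E')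
    (hf' : ∀ E ∈ D.entourages, {p : X × X | (f p.1, f p.2) ∈ E} ∈ C.entourages) :
    C.AsdimLE n := by
  intro E hE
  obtain ⟨E', hE', hEE'⟩ := hf E hE
  obtain ⟨𝒰, hcov, hbdd, hdisj⟩ := h E' hE'
  refine ⟨fun i => (fun U => f ⁻¹' U) '' 𝒰 i, fun x => ?_, fun i => ?_, fun i => ?_⟩
  · obtain ⟨i, U, hU, hx⟩ := hcov (f x)
    exact ⟨i, _, ⟨U, hU, rfl⟩, hx⟩
  · obtain ⟨B, hB, hUB⟩ := hbdd i
    refine ⟨_, hf' B hB, ?_⟩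
    rintro _ ⟨U, hU, rfl⟩ x hx y hy
    exact hUB U hU _ hx _ hy
  · rintro _ ⟨U, hU, rfl⟩ _ ⟨V, hV, rfl⟩ hne x hx y hy hxy
    exact hdisj i U hU V hV (fun h => hne (by rw [h])) _ hx _ hy (hEE' _ hxy)

/-! ### A sparse subsequence with signed sums of full length -/

section Subsequence

variable {G : Type*} [AddCommGroup G]

/-- Sums `∑ i < n, c i` with `c i ∈ {0, a i, -a i}`. -/
def signedPartialSums (a : ℕ → G) (n : ℕ) : Set G :=
  ∑ i ∈ Finset.range n, {0, a i, -a i}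

theorem signedPartialSums_finite (a : ℕ → G) (n : ℕ) : (signedPartialSums a n).Finite := by
  induction n with
  | zero => simp [signedPartialSums]
  | succ n ih =>
    rw [signedPartialSums, Finset.sum_range_succ]
    exact ih.add (((Set.finite_singleton _).insert _).insert _)

theorem signedPartialSums_mono (a : ℕ → G) : Monotone (signedPartialSums a) := by
  refine monotone_nat_of_le_succ fun k x hx => ?_
  rw [signedPartialSums, Finset.sum_range_succ]
  exact ⟨x, hx, 0, Or.inl rfl, add_zero x⟩

theorem add_mem_signedPartialSums {a : ℕ → G} {m n : ℕ} (hmn : m < n) {x c : G}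
    (hx : x ∈ signedPartialSums a m) (hc : c = a m ∨ c = -a m) :
    c + x ∈ signedPartialSums a n := by
  refine signedPartialSums_mono a hmn ?_
  rw [signedPartialSums, Finset.sum_range_succ]
  exact ⟨x, hx, c, Or.inr hc, add_comm x c⟩

variable {a : ℕ → G} {φ : ℕ → ℕ}

theorem sum_mem_signedPartialSums (hφ : StrictMono φ) {c : ℕ → G}
    (hc : ∀ i, c i = a (φ i) ∨ c i = -a (φ i)) (K : Finset ℕ) (n : ℕ) (hK : ∀ i ∈ K, φ i < n) :
    ∑ i ∈ K, c i ∈ signedPartialSums a n := by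
  induction K using Finset.induction_on_max generalizing n with
  | empty =>
    rw [Finset.sum_empty]
    exact signedPartialSums_mono a (Nat.zero_le n) (by simp [signedPartialSums])
  | insert k K hk ih =>
    rw [Finset.sum_insert fun h => lt_irrefl _ (hk k h)]
    exact add_mem_signedPartialSums (hK k (Finset.mem_insert_self k K))
      (ih (φ k) fun i hi => hφ (hk i hi)) (hc k)

/-- Passing to a subsequence, every new term increases the length of the preceding signed sums. -/
theorem exists_subsequence_notMem_nsmul [TopologicalSpace G] [IsTopologicalAddGroup G] [T2Space G]
    (ha : Tendsto a atTop (𝓝 0)) (hne : ∃ᶠ m in atTop, a m ≠ 0) :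
    ∃ φ : ℕ → ℕ, StrictMono φ ∧ (∀ k, a (φ k) ≠ 0) ∧
      ∀ i j, i < j → ∀ x ∈ signedPartialSums a (φ i + 1), ∀ n ≤ φ i, x ∉ n • signedTail a 0 →
        x + a (φ j) ∉ (n + 1) • signedTail a 0 ∧ x - a (φ j) ∉ (n + 1) • signedTail a 0 := by
  -- Given the indices `s` already chosen, only finitely many `x` and `n` are involved, and each
  -- condition holds for all late `m` with `a m ≠ 0`.
  have hstep : ∀ s : Finset ℕ, (∀ i ∈ s, a i ≠ 0) → ∃ m, a m ≠ 0 ∧ ∀ i ∈ s, i < m ∧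
      ∀ x ∈ signedPartialSums a (i + 1), ∀ n ≤ i, x ∉ n • signedTail a 0 →
        x + a m ∉ (n + 1) • signedTail a 0 ∧ x - a m ∉ (n + 1) • signedTail a 0 := by
    intro s _
    have hev : ∀ᶠ m in atTop, ∀ i ∈ s, a m ≠ 0 → i < m ∧
        ∀ x ∈ signedPartialSums a (i + 1), ∀ n ∈ Set.Iic i, x ∉ n • signedTail a 0 →
        x + a m ∉ (n + 1) • signedTail a 0 ∧ x - a m ∉ (n + 1) • signedTail a 0 := by
      refine (Finset.eventually_all s).2 fun i _ => ?_
      have h : ∀ᶠ m in atTop, ∀ x ∈ signedPartialSums a (i + 1), ∀ n ∈ Set.Iic i,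
          x ∉ n • signedTail a 0 → a m ≠ 0 →
          x + a m ∉ (n + 1) • signedTail a 0 ∧ x - a m ∉ (n + 1) • signedTail a 0 := by
        refine (signedPartialSums_finite a _).eventually_all.2 fun x _ =>
          (Set.finite_Iic i).eventually_all.2 fun n _ => ?_
        by_cases hx : x ∈ n • signedTail a 0
        · exact Eventually.of_forall fun _ h => absurd hx h
        · filter_upwards [eventually_add_notMem_nsmul ha hx] with m hm _ using hm
      filter_upwards [h, eventually_gt_atTop i] with m hm him hm0
      exact ⟨him, fun x hx n hn hxn => hm x hx n hn hxn hm0⟩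
    obtain ⟨m, hm0, hm⟩ := (hne.and_eventually hev).exists
    exact ⟨m, hm0, fun i hi => hm i hi hm0⟩
  obtain ⟨φ, hφ0, hφ⟩ := exists_seq_of_forall_finset_exists _ _ hstep
  exact ⟨φ, strictMono_nat_of_lt_succ fun k => (hφ k (k + 1) k.lt_succ_self).1, hφ0,
    fun i j hij => (hφ i j hij).2⟩

/-- Induction by removing the largest index: the remaining sum is not too short, and by `hφa` the
last term makes it longer by one. -/
theorem card_le_of_sum_mem_nsmul (hφ : StrictMono φ) (hφ0 : ∀ k, a (φ k) ≠ 0)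
    (hφa : ∀ i j, i < j → ∀ x ∈ signedPartialSums a (φ i + 1), ∀ n ≤ φ i,
      x ∉ n • signedTail a 0 →
        x + a (φ j) ∉ (n + 1) • signedTail a 0 ∧ x - a (φ j) ∉ (n + 1) • signedTail a 0)
    {c : ℕ → G} (hc : ∀ i, c i = a (φ i) ∨ c i = -a (φ i)) (K : Finset ℕ) (n : ℕ)
    (hK : ∑ i ∈ K, c i ∈ n • signedTail a 0) : K.card ≤ n := by
  induction K using Finset.induction_on_max generalizing n with
  | empty => simp
  | insert k K hk ih =>
    have hkK : k ∉ K := fun h => lt_irrefl _ (hk k h)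
    rw [Finset.sum_insert hkK, add_comm] at hK
    rw [Finset.card_insert_of_notMem hkK]
    rcases K.eq_empty_or_nonempty with rfl | hne
    · rcases n with _ | n
      · rw [Finset.sum_empty, zero_add, zero_smul, Set.mem_zero] at hK
        rcases hc k with h | h
        · exact absurd (h.symm.trans hK) (hφ0 k)
        · exact absurd (neg_eq_zero.1 (h.symm.trans hK)) (hφ0 k)
      · simp
    -- The predecessor `i` of the top index bounds all of `K`, so a counterexample has `n ≤ K.card ≤
    -- i + 1`, giving the bound `n - 1 ≤ φ i` that `hφa` requires.
    obtain ⟨i, rfl⟩ : ∃ i, k = i + 1 := by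
      obtain ⟨i, hi⟩ := hne
      exact Nat.exists_eq_add_one.2 (Nat.zero_lt_of_lt (hk i hi))
    have hKi : K.card ≤ i + 1 := by
      simpa using Finset.card_le_card (show K ⊆ Finset.range (i + 1) from
        fun j hj => Finset.mem_range.2 (hk j hj))
    by_contra! hlt
    have hmem : ∑ j ∈ K, c j ∈ signedPartialSums a (φ i + 1) :=
      sum_mem_signedPartialSums hφ hc K _ fun j hj =>
        Nat.lt_succ_of_le (hφ.monotone (Nat.le_of_lt_succ (hk j hj)))
    -- For `n = 0` the subtraction truncates to `0`; the claim survives because `K` is nonempty.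
    have hKn : ∑ j ∈ K, c j ∉ (n - 1) • signedTail a 0 := by
      intro h
      have h1 := ih _ h
      have h2 := hne.card_pos
      omega
    have hφi := hφ.le_apply (x := i)
    have hn := hφa i (i + 1) i.lt_succ_self _ hmem (n - 1) (by omega) hKn
    have hK' := nsmul_signedTail_mono a 0 (show n ≤ n - 1 + 1 by omega) hK
    rcases hc (i + 1) with h | h
    · rw [h] at hK'
      exact hn.1 hK'
    · rw [h, ← sub_eq_add_neg] at hK'
      exact hn.2 hK'

theorem sum_sub_sum_eq_sum_symmDiff (b : ℕ → G) (F H : Finset ℕ) :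
    ∑ i ∈ F, b i - ∑ i ∈ H, b i =
      ∑ i ∈ symmDiff F H, if i ∈ F then b i else -b i := by
  rw [← Finset.sum_sdiff_sub_sum_sdiff, symmDiff_def, Finset.sup_eq_union,
    Finset.sum_union disjoint_sdiff_sdiff, sub_eq_add_neg, ← Finset.sum_neg_distrib]
  congr 1
  · exact Finset.sum_congr rfl fun i hi => (if_pos (Finset.mem_sdiff.1 hi).1).symm
  · exact Finset.sum_congr rfl fun i hi => (if_neg (Finset.mem_sdiff.1 hi).2).symm

theorem sum_sub_sum_mem_nsmul (φ : ℕ → ℕ) (F H : Finset ℕ) :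
    ∑ i ∈ F, a (φ i) - ∑ i ∈ H, a (φ i) ∈ (symmDiff F H).card • signedTail a 0 := by
  rw [sum_sub_sum_eq_sum_symmDiff]
  refine sum_mem_nsmul_of_mem _ fun i _ => Or.inr ⟨φ i, Nat.zero_le _, ?_⟩
  split_ifs
  · exact Or.inl rfl
  · exact Or.inr rfl

theorem exists_subsequence_card_symmDiff_le [TopologicalSpace G] [IsTopologicalAddGroup G]
    [T2Space G] (ha : Tendsto a atTop (𝓝 0)) (hne : ∃ᶠ m in atTop, a m ≠ 0) :
    ∃ φ : ℕ → ℕ, StrictMono φ ∧ ∀ (F H : Finset ℕ) (n : ℕ),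
      ∑ i ∈ F, a (φ i) - ∑ i ∈ H, a (φ i) ∈ n • signedTail a 0 → (symmDiff F H).card ≤ n := by
  obtain ⟨φ, hφ, hφ0, hφa⟩ := exists_subsequence_notMem_nsmul ha hne
  refine ⟨φ, hφ, fun F H n h => ?_⟩
  rw [sum_sub_sum_eq_sum_symmDiff] at h
  refine card_le_of_sum_mem_nsmul hφ hφ0 hφa (fun i => ?_) _ n h
  split_ifs
  · exact Or.inl rfl
  · exact Or.inr rfl

end Subsequence

/-! ### Precompact differences and the conclusion -/

theorem IsTSequence.t2Space_strongestTopology {G : Type*} [AddCommGroup G] {a : ℕ → G}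
    (ha : IsTSequence a) : @T2Space G (strongestTopology a).toTopologicalSpace := by
  obtain ⟨t, ht, hta⟩ := ha
  have hle : (strongestTopology a).toTopologicalSpace ≤ t.toTopologicalSpace :=
    (isLeast_strongestTopology a).2 hta
  exact t2Space_antitone hle ht

/-- Along a suitable subsequence, the differences of finite sums range over a precompact set if and
only if the symmetric differences of the index sets have bounded size. -/
theorem IsTSequence.exists_subsequence_precompact {G : Type*} [AddCommGroup G] {a : ℕ → G}
    (ha : IsTSequence a) (hnt : ¬ IsTrivialSequence a) :
    ∃ φ : ℕ → ℕ, StrictMono φ ∧ FSStrict (a ∘ φ) ∧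
      (∀ n : ℕ, ∃ P ∈ (AddGroupIdeal.precompact (strongestTopology a)).sets,
        ∀ F H : Finset ℕ, (symmDiff F H).card ≤ n →
          ∑ i ∈ F, a (φ i) - ∑ i ∈ H, a (φ i) ∈ P) ∧
      (∀ P ∈ (AddGroupIdeal.precompact (strongestTopology a)).sets, ∃ n : ℕ,
        ∀ F H : Finset ℕ, ∑ i ∈ F, a (φ i) - ∑ i ∈ H, a (φ i) ∈ P →
          (symmDiff F H).card ≤ n) := by
  let _ := (strongestTopology a).toTopologicalSpace
  have := (strongestTopology a).toIsTopologicalAddGroup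
  have : T2Space G := ha.t2Space_strongestTopology
  have hlim : Tendsto a atTop (𝓝 0) := (isLeast_strongestTopology a).1
  obtain ⟨φ, hφ, hcard⟩ := exists_subsequence_card_symmDiff_le hlim
    (Nat.frequently_atTop_iff_infinite.2 hnt)
  refine ⟨φ, hφ, fun H F h => ?_, fun n => ?_, fun P hP => ?_⟩
  · have h0 := hcard F H 0 (by
      rw [zero_smul, Set.mem_zero, sub_eq_zero]
      exact h.symm)
    exact symmDiff_eq_bot.1 (Finset.card_eq_zero.1 (Nat.le_zero.1 h0))
  · refine ⟨n • signedTail a 0, ?_, fun F H h =>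
      nsmul_signedTail_mono a 0 h (sum_sub_sum_mem_nsmul φ F H)⟩
    exact (isCompact_nsmul_signedTail hlim 0 n).closure
  -- Cutting `P` down to finite signed sums loses nothing, since every difference considered is one.
  · have hP' := (AddGroupIdeal.precompact (strongestTopology a)).subset_mem P hP
      (P ∩ ⋃ n : ℕ, n • signedTail a 0) Set.inter_subset_left
    obtain ⟨n, hn⟩ := exists_subset_nsmul_of_isCompact_closure hlim (tailSums_mem_nhds_zero a) hP'
      Set.inter_subset_right
    exact ⟨n, fun F H h => hcard F H n
      (hn ⟨h, Set.mem_iUnion.2 ⟨_, sum_sub_sum_mem_nsmul φ F H⟩⟩)⟩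

theorem theorem3 {G : Type*} [AddCommGroup G] (a : ℕ → G) (ha : IsTSequence a)
    (hnt : ¬ IsTrivialSequence a) :
    (∃ φ : ℕ → ℕ, StrictMono φ ∧ FSStrict (a ∘ φ) ∧
      ∃ f : Finset ℕ ≃ finiteSums (a ∘ φ),
        (∀ F : Finset ℕ, (f F : G) = ∑ i ∈ F, a (φ i)) ∧
        CoarseStructure.IsAsymorphism hammingSpace
          ((coarseGroupOfSeq a).subspace (finiteSums (a ∘ φ))) f) ∧
    (coarseGroupOfSeq a).asdim = ⊤ := by
  obtain ⟨φ, hφ, hFS, hup, hlow⟩ := ha.exists_subsequence_precompact hnt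
  have hf : ∀ E ∈ hammingSpace.entourages, ∃ E' ∈ (coarseGroupOfSeq a).entourages,
      ∀ p ∈ E, (∑ i ∈ p.1, a (φ i), ∑ i ∈ p.2, a (φ i)) ∈ E' := by
    rintro E ⟨hE, n, hn⟩
    obtain ⟨P, hP, hPn⟩ := hup n
    -- Needed for the relation given by `P` to be reflexive.
    have h0 : (0 : G) ∈ P := by simpa using hPn ∅ ∅ (by simp)
    exact ⟨{p | p.1 - p.2 ∈ P}, ⟨fun x => by simpa using h0, P, hP, fun _ h => h⟩,
      fun p hp => hPn _ _ (hn p hp)⟩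
  have hf' : ∀ E ∈ (coarseGroupOfSeq a).entourages,
      {p : Finset ℕ × Finset ℕ | (∑ i ∈ p.1, a (φ i), ∑ i ∈ p.2, a (φ i)) ∈ E} ∈
        hammingSpace.entourages := by
    rintro E ⟨hE, P, hP, hEP⟩
    obtain ⟨n, hn⟩ := hlow P hP
    exact ⟨fun F => hE _, n, fun p hp => hn _ _ (hEP _ hp)⟩
  obtain ⟨f, hfv⟩ : ∃ f : Finset ℕ ≃ finiteSums (a ∘ φ), ∀ F, (f F : G) = ∑ i ∈ F, a (φ i) :=
    ⟨Equiv.ofInjective (fun F : Finset ℕ => ∑ i ∈ F, (a ∘ φ) i) fun F H h => (hFS F H h).symm,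
      fun _ => rfl⟩
  refine ⟨⟨φ, hφ, hFS, f, hfv, fun E hE => ?_, ?_⟩, ?_⟩
  · obtain ⟨E', hE', h⟩ := hf E hE
    refine ⟨_, ⟨E', hE', rfl⟩, fun F => ?_⟩
    rintro _ ⟨H, hH, rfl⟩
    change ((f F : G), (f H : G)) ∈ E'
    rw [hfv, hfv]
    exact h (F, H) hH
  · rintro _ ⟨E, hE, rfl⟩
    refine ⟨_, hf' E hE, fun x => ?_⟩
    rintro _ ⟨y, hy, rfl⟩
    change (∑ i ∈ f.symm x, a (φ i), ∑ i ∈ f.symm y, a (φ i)) ∈ E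
    rw [← hfv, ← hfv, f.apply_symm_apply, f.apply_symm_apply]
    exact hy
  · refine iInf_eq_top.2 fun n => iInf_eq_top.2 fun hn => ?_
    exact absurd (hn.of_coarse_embedding (fun F : Finset ℕ => ∑ i ∈ F, a (φ i)) hf hf')
      (not_asdimLE_hammingSpace n)
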